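/- A *measure* on an ordinal $\alpha>\omega$ is a nonprincipal, $\alpha$-complete, normal ultrafilter on $\alpha$. A *coherent sequence of measures* is a function $\vec{\mathcal U}$ with domain $\{(\alpha,\beta) : \alpha<l,\ \beta<o^{\mathcal U}(\alpha)\}$, for some ordinal $l$ and some ordinal-valued function $o^{\mathcal U}$, such that for every $(\alpha,\beta)$ in the domain: (i) $\mathcal U^\alpha_\beta=\vec{\mathcal U}(\alpha,\beta)$ is a measure on $\alpha$; (ii) if $j:V\to V^\alpha/\mathcal U^\alpha_\beta$ is the canonical embedding into the transitive collapse of the ultrapower, then $j(\vec{\mathcal U})\restriction(\alpha+1)=\vec{\mathcal U}\restriction(\alpha,\beta)$, where $\restriction(\alpha,\beta)$ denotes restriction to the pairs $(\alpha',\beta')$ with $\alpha'<\alpha$, or $\alpha'=\alpha$ and $\beta'<\beta$, and $\restriction(\alpha+1)$ means $\restriction(\alpha+1,0)$. For $\delta<o^{\mathcal U}(\lambda)$, the measure $\mathcal U^\lambda_\delta$ is a *repeat point* if every $X\in\mathcal U^\lambda_\delta$ belongs to $\mathcal U^\lambda_{\delta'}$ for some $\delta'<\delta$. Let $\theta_\lambda$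 be the least $\theta<o^{\mathcal U}(\lambda)$ such that $\mathcal U^\lambda_\theta$ is a repeat point if there is one, and $\theta_\lambda=o^{\mathcal U}(\lambda)$ otherwise. **Proposition 3.1.** Let $\vec{\mathcal U}$ be a coherent sequence of measures of length $l$ and let $\lambda<l$. 1. If $\delta<o^{\mathcal U}(\lambda)$ and $\mathcal U^\lambda_\delta$ is not a repeat point, then there is a set $E\in\mathcal U^\lambda_\delta$ such that $E\notin\mathcal U^\lambda_{\delta'}$ for every $\delta'<o^{\mathcal U}(\lambda)$ with $\delta'\neq\delta$. 2. Consequently there is a sequence $\langle E_\delta : \delta<\theta_\lambda\rangle$ of sets of regular cardinals below $\lambda$ such that for all $\delta<\theta_\lambda$ and all $\delta'<o^{\mathcal U}(\lambda)$, $E_\delta\in\mathcal U^\lambda_{\delta'}$ if and only if $\delta=\delta'$. -/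

import Mathlib

universe u

/-!  The universe of sets `V` is Mathlib's model `ZFSet.{u}` of ZFC; its ordinals are `Ordinal.{u}`,
and `Set.Iio α` is the ordinal `α` viewed as the set of smaller ordinals. -/

namespace MitchellOrder

open Filter Set

/-! ### Measures -/

/-- A measure on the ordinal `α`: a nonprincipal, `α`-complete, normal ultrafilter on the
(uncountable) `α`. -/
structure IsMeasure (α : Ordinal.{u}) (D : Filter (Iio α)) : Prop where
  uncountable : Ordinal.omega0 < α
  ultra : ∀ A : Set (Iio α), Aᶜ ∉ D ↔ A ∈ D
  nonprincipal : ∀ ξ : Iio α, ({ξ} : Set (Iio α)) ∉ D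
  complete : ∀ γ < α, ∀ A : Iio γ → Set (Iio α), (∀ i, A i ∈ D) → (⋂ i, A i) ∈ D
  normal : ∀ f : Iio α → Iio α, (∀ᶠ ξ in D, f ξ < ξ) → ∃ γ : Iio α, ∀ᶠ ξ in D, f ξ = γ

/-! ### The ultrapower of the universe and its transitive collapse -/

/-- The (uncollapsed) ultrapower of the universe of sets by `D`. -/
abbrev Ult {α : Ordinal.{u}} (D : Filter (Iio α)) : Type (u + 1) :=
  Germ D ZFSet.{u}

/-- The membership relation of the ultrapower. -/
def Ult.Mem {α : Ordinal.{u}} {D : Filter (Iio α)} (x y : Ult D) : Prop :=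
  Germ.LiftRel (fun a b : ZFSet.{u} => a ∈ b) x y

/-- The membership relation of the ultrapower is set-like. -/
instance Ult.small_mem {α : Ordinal.{u}} {D : Filter (Iio α)} (y : Ult D) :
    Small.{u} {x : Ult D // Ult.Mem x y} := by
  induction y using Germ.inductionOn with
  | _ g =>
    let t : Iio α → ZFSet.{u} := fun ξ => insert ∅ (g ξ)
    let h : (∀ ξ : Iio α, {a : ZFSet.{u} // a ∈ t ξ}) → Ult D :=
      fun k => ((fun ξ => (k ξ).1 : Iio α → ZFSet.{u}) : Ult D)
    have h1 : ∀ ξ : Iio α, Small.{u} {a : ZFSet.{u} // a ∈ t ξ} := fun ξ => ZFSet.small_coe (t ξ)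
    have h2 : Small.{u} (range h) := small_range h
    suffices hsub : {x : Ult D | Ult.Mem x g} ⊆ range h from small_subset hsub
    intro x hx
    induction x using Germ.inductionOn with
    | _ f =>
      have hx' : ∀ᶠ ξ in D, f ξ ∈ g ξ := hx
      classical
      refine ⟨fun ξ => if hf : f ξ ∈ g ξ then ⟨f ξ, ZFSet.mem_insert_iff.2 (Or.inr hf)⟩
        else ⟨∅, ZFSet.mem_insert_iff.2 (Or.inl rfl)⟩, ?_⟩
      refine Germ.coe_eq.2 ?_
      filter_upwards [hx'] with ξ hξ
      simp [hξ]

theorem IsMeasure.neBot {α : Ordinal.{u}} {D : Filter (Iio α)} (hD : IsMeasure α D) : D.NeBot :=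
  ⟨fun h => (hD.ultra ∅).2 (h ▸ mem_bot) (h ▸ mem_bot)⟩

/-- The ultrapower by a measure is well-founded. -/
theorem IsMeasure.wellFounded {α : Ordinal.{u}} {D : Filter (Iio α)} (hD : IsMeasure α D) :
    WellFounded (Ult.Mem : Ult D → Ult D → Prop) := by
  rw [wellFounded_iff_isEmpty_descending_chain]
  refine ⟨fun ⟨s, hs⟩ => ?_⟩
  choose f hf using fun n => Quotient.exists_rep (s n)
  have hmem : ∀ n, {ξ | f (n + 1) ξ ∈ f n ξ} ∈ D := by
    intro n
    have := hs n
    rw [← hf n, ← hf (n + 1)] at this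
    exact this
  choose k hk using fun i : Iio Ordinal.omega0.{u} => Ordinal.lt_omega0.1 i.2
  have hall := hD.complete Ordinal.omega0 hD.uncountable
    (fun i => {ξ | f (k i + 1) ξ ∈ f (k i) ξ}) (fun i => hmem (k i))
  have := hD.neBot
  obtain ⟨ξ, hξ⟩ := Filter.nonempty_of_mem hall
  rw [mem_iInter] at hξ
  have key : ∀ n, f (n + 1) ξ ∈ f n ξ := by
    intro n
    have h1 := hξ ⟨(n : Ordinal.{u}), Ordinal.natCast_lt_omega0 n⟩
    have h2 : n = k ⟨(n : Ordinal.{u}), Ordinal.natCast_lt_omega0 n⟩ := by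
      have := hk ⟨(n : Ordinal.{u}), Ordinal.natCast_lt_omega0 n⟩
      exact Nat.cast_injective (R := Ordinal.{u}) this
    rw [← h2] at h1
    exact h1
  exact (wellFounded_iff_isEmpty_descending_chain.1 ZFSet.mem_wf).false ⟨fun n => f n ξ, key⟩

/-- The Mostowski collapse of the ultrapower by a measure: `π x = {π y | y Mem x}`. -/
noncomputable def collapse {α : Ordinal.{u}} {D : Filter (Iio α)} (hD : IsMeasure α D) :
    Ult D → ZFSet.{u} :=
  hD.wellFounded.fix fun x π => ZFSet.range fun y : {y : Ult D // Ult.Mem y x} => π y.1 y.2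

theorem mem_collapse {α : Ordinal.{u}} {D : Filter (Iio α)} (hD : IsMeasure α D)
    (x : Ult D) (z : ZFSet.{u}) :
    z ∈ collapse hD x ↔ ∃ y : Ult D, Ult.Mem y x ∧ collapse hD y = z := by
  unfold collapse
  rw [hD.wellFounded.fix_eq, ZFSet.mem_range]
  constructor
  · rintro ⟨⟨y, hy⟩, rfl⟩
    exact ⟨y, hy, rfl⟩
  · rintro ⟨y, hy, rfl⟩
    exact ⟨⟨y, hy⟩, rfl⟩

/-- The canonical embedding `j : V → V^α/D` into the transitive collapse of the ultrapower:
`j a` is the (collapse of the) class of the constant function with value `a`. -/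
noncomputable def canonicalEmbedding {α : Ordinal.{u}} {D : Filter (Iio α)}
    (hD : IsMeasure α D) (a : ZFSet.{u}) : ZFSet.{u} :=
  collapse hD ((fun _ => a : Iio α → ZFSet.{u}) : Ult D)

/-! ### Sequences of measures as elements of the universe -/

/-- A filter on `α` as an element of the universe: the set of its members, each of which is a
set of von Neumann ordinals. -/
noncomputable def measureCode {α : Ordinal.{u}} (D : Filter (Iio α)) : ZFSet.{u} :=
  α.toZFSet.powerset.sep fun x => {ξ : Iio α | ξ.1.toZFSet ∈ x} ∈ D

/-- The function `(α, β) ↦ U α β` with domain `{(α, β) | α < l and β < o α}` as an element of the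
universe: the set of pairs `((α, β), U α β)`. -/
noncomputable def sequenceCode (l : Ordinal.{u}) (o : Ordinal.{u} → Ordinal.{u})
    (U : ∀ α : Ordinal.{u}, Ordinal.{u} → Filter (Iio α)) : ZFSet.{u} :=
  ZFSet.range fun p : (Σ α : Iio l, Iio (o α.1)) =>
    ZFSet.pair (ZFSet.pair p.1.1.toZFSet p.2.1.toZFSet) (measureCode (U p.1.1 p.2.1))

/-- The restriction of a function `F` in the universe, defined on pairs of ordinals, to
`{(α', β') | α' < α, or α' = α and β' < β}`. -/
noncomputable def restrict (F : ZFSet.{u}) (α β : Ordinal.{u}) : ZFSet.{u} :=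
  F.sep fun p => ∃ (α' β' : Ordinal.{u}) (v : ZFSet.{u}), (α' < α ∨ α' = α ∧ β' < β) ∧
    p = ZFSet.pair (ZFSet.pair α'.toZFSet β'.toZFSet) v

/-! ### Coherent sequences and repeat points -/

/-- A coherent sequence of measures of length `length`, with `o` in the role of `o^U`. The values of
`o α` for `length ≤ α`, and of `U α β` outside the domain `α < length`, `β < o α`, are irrelevant. -/
structure CoherentSequence where
  length : Ordinal.{u}
  o : Ordinal.{u} → Ordinal.{u}
  U : ∀ α : Ordinal.{u}, Ordinal.{u} → Filter (Iio α)
  isMeasure : ∀ α < length, ∀ β < o α, IsMeasure α (U α β)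
  /-- `j(U) ↾ (α + 1) = U ↾ (α, β)`, where `j` is the canonical embedding given by `U α β`. -/
  coherent : ∀ (α : Ordinal.{u}) (hα : α < length) (β : Ordinal.{u}) (hβ : β < o α),
    restrict (canonicalEmbedding (isMeasure α hα β hβ) (sequenceCode length o U)) (α + 1) 0 =
      restrict (sequenceCode length o U) α β

namespace CoherentSequence

/-- The measure `U^lam_δ` is a repeat point: each of its members belongs to an earlier measure. -/
def IsRepeatPoint (S : CoherentSequence.{u}) (lam δ : Ordinal.{u}) : Prop :=
  ∀ X ∈ S.U lam δ, ∃ δ' < δ, X ∈ S.U lam δ'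

open Classical in
/-- `θ_lam`: the least `θ < o lam` such that `U^lam_θ` is a repeat point, and `o lam` if there is
no such `θ`. -/
noncomputable def theta (S : CoherentSequence.{u}) (lam : Ordinal.{u}) : Ordinal.{u} :=
  if ∃ θ < S.o lam, S.IsRepeatPoint lam θ then sInf {θ | θ < S.o lam ∧ S.IsRepeatPoint lam θ}
  else S.o lam

end CoherentSequence

/-- `Reg lam`: the set of all regular cardinals below `lam` (as initial ordinals). -/
def Reg (lam : Ordinal.{u}) : Set (Iio lam) :=
  {ξ | ∃ c : Cardinal.{u}, c.IsRegular ∧ ξ.1 = c.ord}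

end MitchellOrder

namespace MitchellOrder

open Filter Set

/-! ### Combinatorics of measures -/

namespace IsMeasure

variable {α : Ordinal.{u}} {D : Filter (Iio α)}

/-! By coherence, the ultrapower by `U lam δ` sees at `lam` exactly the measures `U lam δ'` with `δ'
< δ`. Since the identity represents `lam` and `ξ ↦ X ∩ ξ` represents `X ∩ lam`, this turns "some
earlier measure contains `X`" into "`X ∩ ξ` lies in some measure on `ξ`, for almost all `ξ`"
(`exists_lt_mem_iff`). If `X` witnesses that `U lam δ` is not a repeat point, let `E` be the set of
`ξ ∈ X` such that no measure on `ξ` contains `X ∩ ξ`. Reflection at `δ` gives `E ∈ U lam δ`. Earlier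
measures omit `X`, hence `E`. For a later measure, `U lam δ` is itself an earlier measure containing
`X`, so reflection there excludes `E`. Intersecting with `Reg lam` (`IsMeasure.reg_mem`) gives the
sequence. Of Łoś's theorem only equality, membership, pairs and ordinals are needed. -/

theorem eventually_not_iff (hD : IsMeasure α D) {p : Iio α → Prop} :
    (∀ᶠ ξ in D, ¬ p ξ) ↔ ¬ ∀ᶠ ξ in D, p ξ := by
  have h := hD.ultra {ξ | p ξ}
  exact ⟨fun h1 h2 => h.2 h2 h1, fun h1 => by_contra fun h2 => h1 (h.1 h2)⟩

theorem eventually_or_iff (hD : IsMeasure α D) {p q : Iio α → Prop} :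
    (∀ᶠ ξ in D, p ξ ∨ q ξ) ↔ (∀ᶠ ξ in D, p ξ) ∨ ∀ᶠ ξ in D, q ξ := by
  refine ⟨fun h => or_iff_not_imp_left.2 fun hp => ?_, ?_⟩
  · filter_upwards [h, hD.eventually_not_iff.2 hp] with ξ h1 h2
    exact h1.resolve_left h2
  · rintro (h | h)
    · exact h.mono fun _ => Or.inl
    · exact h.mono fun _ => Or.inr

theorem eventually_ne (hD : IsMeasure α D) (ξ : Iio α) : ∀ᶠ η in D, η ≠ ξ :=
  hD.eventually_not_iff.2 (hD.nonprincipal ξ)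

theorem eventually_forall_lt (hD : IsMeasure α D) {γ : Ordinal.{u}} (hγ : γ < α)
    {p : Iio γ → Iio α → Prop} (h : ∀ i, ∀ᶠ ξ in D, p i ξ) : ∀ᶠ ξ in D, ∀ i, p i ξ := by
  filter_upwards [hD.complete γ hγ (fun i => {ξ | p i ξ}) h] with ξ hξ i
  exact mem_iInter.1 hξ i

theorem eventually_gt (hD : IsMeasure α D) {γ : Ordinal.{u}} (hγ : γ < α) :
    ∀ᶠ ξ in D, γ < ξ.1 := by
  have h := hD.eventually_forall_lt hγ (p := fun i ξ => ξ ≠ ⟨i.1, i.2.trans hγ⟩)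
    fun i => hD.eventually_ne _
  filter_upwards [h, hD.eventually_ne ⟨γ, hγ⟩] with ξ h1 h2
  refine lt_of_le_of_ne (not_lt.1 fun hlt => h1 ⟨ξ.1, hlt⟩ rfl) fun h3 => h2 (Subtype.ext h3.symm)

/-- A regressive ordinal-valued function is constant on a set of measure one. -/
theorem exists_eventually_eq (hD : IsMeasure α D) {f : Iio α → Ordinal.{u}}
    (hf : ∀ᶠ ξ in D, f ξ < ξ.1) : ∃ γ < α, ∀ᶠ ξ in D, f ξ = γ := by
  classical
  obtain ⟨γ, hγ⟩ := hD.normal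
    (fun ξ => if h : f ξ < ξ.1 then ⟨f ξ, h.trans ξ.2⟩ else ξ) <| by
      filter_upwards [hf] with ξ hξ
      rw [dif_pos hξ]
      exact hξ
  refine ⟨γ.1, γ.2, ?_⟩
  filter_upwards [hf, hγ] with ξ h1 h2
  rw [dif_pos h1] at h2
  exact congrArg Subtype.val h2

theorem exists_eventually_eq_toZFSet (hD : IsMeasure α D) {f : Iio α → ZFSet.{u}}
    (hf : ∀ᶠ ξ in D, f ξ ∈ ξ.1.toZFSet) : ∃ γ < α, ∀ᶠ ξ in D, f ξ = γ.toZFSet := by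
  have h : ∀ᶠ ξ in D, (f ξ).rank < ξ.1 ∧ (f ξ).rank.toZFSet = f ξ := by
    filter_upwards [hf] with ξ hξ
    obtain ⟨a, ha, h⟩ := Ordinal.mem_toZFSet_iff.1 hξ
    rw [← h, Ordinal.rank_toZFSet]
    exact ⟨ha, rfl⟩
  obtain ⟨γ, hγ, h1⟩ := hD.exists_eventually_eq (h.mono fun _ => And.left)
  refine ⟨γ, hγ, ?_⟩
  filter_upwards [h, h1] with ξ h2 h3
  rw [← h3, h2.2]

end IsMeasure

/-- Enumerating a cofinal set by the ordinal `ξ.cof.ord` lets all `ξ` of equal cofinality share one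
index set. -/
theorem exists_cofinal_map (ξ : Ordinal.{u}) :
    ∃ g : Iio ξ.cof.ord → Ordinal.{u}, (∀ i, g i < ξ) ∧ ∀ η < ξ, ∃ i, η ≤ g i := by
  obtain ⟨s, hs, ht⟩ := Ordinal.exists_ord_cof_eq (Iio ξ)
  have h : Ordinal.type ((· < ·) : Iio ξ.cof.ord → Iio ξ.cof.ord → Prop) =
      Ordinal.type ((· < ·) : s → s → Prop) := by
    rw [ht, Ordinal.cof_Iio, ← Ordinal.lift_cof, ← Cardinal.lift_ord]
    exact Ordinal.type_lt_Iio _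
  obtain ⟨e⟩ := Ordinal.type_eq.1 h
  refine ⟨fun i => (e i).1.1, fun i => (e i).1.2, fun η hη => ?_⟩
  obtain ⟨b, hb, hle⟩ := hs ⟨η, hη⟩
  refine ⟨e.symm ⟨b, hb⟩, ?_⟩
  change η ≤ (e (e.symm ⟨b, hb⟩)).1.1
  rw [RelIso.apply_symm_apply]
  exact hle

theorem cof_ord_lt_of_not_regular {ξ : Ordinal.{u}} (h0 : Ordinal.omega0 < ξ)
    (h : ¬ ∃ c : Cardinal.{u}, c.IsRegular ∧ ξ = c.ord) : ξ.cof.ord < ξ := by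
  refine lt_of_le_of_ne (Ordinal.ord_cof_le ξ) fun heq => h ⟨ξ.cof, ⟨?_, ?_⟩, heq.symm⟩
  · rw [← Cardinal.ord_le_ord, heq, Cardinal.ord_aleph0]
    exact h0.le
  · rw [Ordinal.cof_ord_cof]

/-- A measure on `α` concentrates on the regular cardinals below `α`. -/
theorem IsMeasure.reg_mem {α : Ordinal.{u}} {D : Filter (Iio α)} (hD : IsMeasure α D) :
    Reg α ∈ D := by
  have := hD.neBot
  by_contra hreg
  have hnot : ∀ᶠ ξ in D, ξ ∉ Reg α := hD.eventually_not_iff.2 hreg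
  -- Off the regular cardinals the cofinality is regressive, so it is almost everywhere a fixed `γ`.
  -- Each coordinate of the cofinal maps is regressive too, hence almost constant, and completeness
  -- handles all `γ` coordinates at once.
  obtain ⟨γ, hγ, hcof⟩ := hD.exists_eventually_eq (f := fun ξ => ξ.1.cof.ord) <| by
    filter_upwards [hnot, hD.eventually_gt hD.uncountable] with ξ h1 h2
    exact cof_ord_lt_of_not_regular h2 h1
  obtain ⟨g, hg⟩ := (hcof.mono fun ξ (hξ : ξ.1.cof.ord = γ) =>
    (hξ ▸ exists_cofinal_map ξ.1 : ∃ g : Iio γ → Ordinal.{u},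
      (∀ i, g i < ξ.1) ∧ ∀ η < ξ.1, ∃ i, η ≤ g i)).choice
  choose c hcα hc using fun i =>
    hD.exists_eventually_eq (f := fun ξ => g ξ i) (hg.mono fun ξ hξ => hξ.1 i)
  have hall := hg.and (hD.eventually_forall_lt hγ hc)
  obtain ⟨ξ, hξ, hξc⟩ := hall.exists
  -- Two points `ξ < η` now have the same cofinal map: it is bounded by `ξ`, yet cofinal in `η`.
  obtain ⟨η, ⟨hη, hηc⟩, hlt⟩ := (hall.and (hD.eventually_gt ξ.2)).exists
  obtain ⟨i, hi⟩ := hη.2 ξ.1 hlt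
  rw [hηc i, ← hξc i] at hi
  exact (hξ.1 i).not_ge hi

/-! ### The collapse of the ultrapower -/

section Collapse

variable {α : Ordinal.{u}} {D : Filter (Iio α)} (hD : IsMeasure α D)

theorem mem_collapse_coe (g : Iio α → ZFSet.{u}) (z : ZFSet.{u}) :
    z ∈ collapse hD (g : Ult D) ↔
      ∃ f : Iio α → ZFSet.{u}, (∀ᶠ ξ in D, f ξ ∈ g ξ) ∧ collapse hD (f : Ult D) = z := by
  rw [mem_collapse]
  refine ⟨fun ⟨y, hy, hz⟩ => ?_, fun ⟨f, hf, hz⟩ => ⟨f, hf, hz⟩⟩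
  induction y using Germ.inductionOn with
  | _ f => exact ⟨f, hy, hz⟩

theorem collapse_congr {f g : Iio α → ZFSet.{u}} (h : ∀ᶠ ξ in D, f ξ = g ξ) :
    collapse hD (f : Ult D) = collapse hD (g : Ult D) :=
  congrArg _ (Germ.coe_eq.2 h)

/-- Extensionality of the ultrapower: if `f` and `g` differ almost everywhere, one of the two
differences is almost everywhere nonempty, and a choice function from it is a separating element. In
both cases the induction hypothesis is applied to a member of `f`. -/
theorem collapse_injective : Function.Injective (collapse hD) := by
  intro x
  induction x using hD.wellFounded.induction with
  | _ x ih =>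
    intro y hxy
    induction x using Germ.inductionOn with
    | _ f =>
    induction y using Germ.inductionOn with
    | _ g =>
    refine Germ.coe_eq.2 (by_contra fun hne => ?_)
    have hsplit : ∀ᶠ ξ in D, (∃ z, z ∈ f ξ ∧ z ∉ g ξ) ∨ ∃ z, z ∈ g ξ ∧ z ∉ f ξ := by
      filter_upwards [hD.eventually_not_iff.2 hne] with ξ hξ
      by_contra! hcon
      exact hξ (ZFSet.ext fun z => ⟨hcon.1 z, hcon.2 z⟩)
    have := hD.neBot
    rcases hD.eventually_or_iff.1 hsplit with h | h
    · obtain ⟨k, hk⟩ := h.choice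
      have hkf : Ult.Mem (k : Ult D) f := hk.mono fun _ => And.left
      have h1 : collapse hD (k : Ult D) ∈ collapse hD (g : Ult D) :=
        hxy ▸ (mem_collapse hD _ _).2 ⟨k, hkf, rfl⟩
      obtain ⟨m, hm, hmk⟩ := (mem_collapse_coe hD _ _).1 h1
      have heq : ∀ᶠ ξ in D, k ξ = m ξ := Germ.coe_eq.1 (ih _ hkf hmk.symm)
      obtain ⟨ξ, h2, h3, h4⟩ := (hk.and (hm.and heq)).exists
      exact h2.2 (h4 ▸ h3)
    · obtain ⟨k, hk⟩ := h.choice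
      have hkg : Ult.Mem (k : Ult D) g := hk.mono fun _ => And.left
      have h1 : collapse hD (k : Ult D) ∈ collapse hD (f : Ult D) :=
        hxy ▸ (mem_collapse hD _ _).2 ⟨k, hkg, rfl⟩
      obtain ⟨m, hm, hmk⟩ := (mem_collapse_coe hD _ _).1 h1
      have heq : ∀ᶠ ξ in D, m ξ = k ξ := Germ.coe_eq.1 (ih (m : Ult D) hm hmk)
      obtain ⟨ξ, h2, h3, h4⟩ := (hk.and (hm.and heq)).exists
      exact h2.2 (h4 ▸ h3)

theorem collapse_eq_collapse_iff {f g : Iio α → ZFSet.{u}} :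
    collapse hD (f : Ult D) = collapse hD (g : Ult D) ↔ ∀ᶠ ξ in D, f ξ = g ξ :=
  ⟨fun h => Germ.coe_eq.1 (collapse_injective hD h), collapse_congr hD⟩

theorem collapse_mem_collapse_iff {f g : Iio α → ZFSet.{u}} :
    collapse hD (f : Ult D) ∈ collapse hD (g : Ult D) ↔ ∀ᶠ ξ in D, f ξ ∈ g ξ := by
  refine ⟨fun h => ?_, fun h => (mem_collapse hD _ _).2 ⟨f, h, rfl⟩⟩
  obtain ⟨k, hk, hkf⟩ := (mem_collapse_coe hD _ _).1 h
  filter_upwards [hk, (collapse_eq_collapse_iff hD).1 hkf] with ξ h1 h2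
  exact h2 ▸ h1

theorem collapse_insert_singleton (f g : Iio α → ZFSet.{u}) :
    collapse hD ((fun ξ => {f ξ, g ξ} : Iio α → ZFSet.{u}) : Ult D) =
      {collapse hD (f : Ult D), collapse hD (g : Ult D)} := by
  ext z
  rw [mem_collapse_coe, ZFSet.mem_pair]
  constructor
  · rintro ⟨k, hk, rfl⟩
    simpa only [collapse_eq_collapse_iff, ZFSet.mem_pair, hD.eventually_or_iff] using hk
  · rintro (rfl | rfl)
    · exact ⟨f, Eventually.of_forall fun ξ => ZFSet.mem_pair.2 (Or.inl rfl), rfl⟩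
    · exact ⟨g, Eventually.of_forall fun ξ => ZFSet.mem_pair.2 (Or.inr rfl), rfl⟩

theorem collapse_pair (f g : Iio α → ZFSet.{u}) :
    collapse hD ((fun ξ => ZFSet.pair (f ξ) (g ξ) : Iio α → ZFSet.{u}) : Ult D) =
      ZFSet.pair (collapse hD (f : Ult D)) (collapse hD (g : Ult D)) := by
  -- Writing `{x}` as `{x, x}` leaves only unordered pairs to collapse.
  have h : ∀ x y : ZFSet.{u}, ZFSet.pair x y = {{x, x}, {x, y}} := fun x y => by
    rw [ZFSet.pair, ZFSet.pair_eq_singleton]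
  simp only [h]
  rw [collapse_insert_singleton, collapse_insert_singleton, collapse_insert_singleton]

theorem isTransitive_collapse {f : Iio α → ZFSet.{u}} (hf : ∀ᶠ ξ in D, (f ξ).IsTransitive) :
    (collapse hD (f : Ult D)).IsTransitive := by
  rw [ZFSet.isTransitive_iff_mem_trans]
  intro x y hx hy
  obtain ⟨g, hg, rfl⟩ := (mem_collapse_coe hD _ _).1 hy
  obtain ⟨k, hk, rfl⟩ := (mem_collapse_coe hD _ _).1 hx
  refine (collapse_mem_collapse_iff hD).2 ?_
  filter_upwards [hf, hg, hk] with ξ h1 h2 h3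
  exact h1.mem_trans h3 h2

theorem isOrdinal_collapse {f : Iio α → ZFSet.{u}} (hf : ∀ᶠ ξ in D, (f ξ).IsOrdinal) :
    (collapse hD (f : Ult D)).IsOrdinal := by
  rw [ZFSet.isOrdinal_iff_forall_mem_isTransitive]
  refine ⟨isTransitive_collapse hD (hf.mono fun _ h => h.isTransitive), fun y hy => ?_⟩
  obtain ⟨g, hg, rfl⟩ := (mem_collapse_coe hD _ _).1 hy
  refine isTransitive_collapse hD ?_
  filter_upwards [hf, hg] with ξ h1 h2
  exact (h1.mem h2).isTransitive

/-- The critical point of the canonical embedding is at least `α`. -/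
theorem collapse_const_toZFSet {γ : Ordinal.{u}} (hγ : γ < α) :
    collapse hD ((fun _ => γ.toZFSet : Iio α → ZFSet.{u}) : Ult D) = γ.toZFSet := by
  induction γ using WellFoundedLT.induction with
  | _ γ ih =>
    ext z
    rw [mem_collapse_coe, Ordinal.mem_toZFSet_iff]
    constructor
    · rintro ⟨f, hf, rfl⟩
      -- Almost all `ξ` exceed `γ`, so a function into `γ` is regressive.
      obtain ⟨β, hβ, h⟩ := hD.exists_eventually_eq_toZFSet (f := f) <| by
        filter_upwards [hf, hD.eventually_gt hγ] with ξ h1 h2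
        exact Ordinal.toZFSet_monotone h2.le h1
      have := hD.neBot
      obtain ⟨ξ, h1, h2⟩ := (hf.and h).exists
      have hβγ : β < γ := by rwa [h2, Ordinal.toZFSet_mem_toZFSet_iff] at h1
      exact ⟨β, hβγ, by rw [collapse_congr hD h, ih β hβγ hβ]⟩
    · rintro ⟨β, hβ, rfl⟩
      exact ⟨fun _ => β.toZFSet,
        Eventually.of_forall fun _ => Ordinal.toZFSet_mem_toZFSet_iff.2 hβ, ih β hβ (hβ.trans hγ)⟩

end Collapse

/-! ### Codes of sets of ordinals -/

/-- The set `{ξ < α | ξ ∈ X}` as an element of the universe. -/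
noncomputable def setCode (X : Set Ordinal.{u}) (α : Ordinal.{u}) : ZFSet.{u} :=
  α.toZFSet.sep fun z => z.rank ∈ X

theorem mem_setCode {X : Set Ordinal.{u}} {α : Ordinal.{u}} {z : ZFSet.{u}} :
    z ∈ setCode X α ↔ ∃ γ < α, γ ∈ X ∧ γ.toZFSet = z := by
  rw [setCode, ZFSet.mem_sep, Ordinal.mem_toZFSet_iff]
  constructor
  · rintro ⟨⟨γ, hγ, rfl⟩, h⟩
    exact ⟨γ, hγ, by rwa [Ordinal.rank_toZFSet] at h, rfl⟩
  · rintro ⟨γ, hγ, h, rfl⟩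
    exact ⟨⟨γ, hγ, rfl⟩, by rwa [Ordinal.rank_toZFSet]⟩

theorem setCode_univ (α : Ordinal.{u}) : setCode univ α = α.toZFSet := by
  ext z
  simp [mem_setCode, Ordinal.mem_toZFSet_iff]

theorem setCode_mem_measureCode {X : Set Ordinal.{u}} {α : Ordinal.{u}} {D : Filter (Iio α)} :
    setCode X α ∈ measureCode D ↔ Subtype.val ⁻¹' X ∈ D := by
  have h : {ξ : Iio α | ξ.1.toZFSet ∈ setCode X α} = Subtype.val ⁻¹' X := by
    ext ξ
    simp only [mem_ofPred_eq, mem_setCode, mem_preimage]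
    constructor
    · rintro ⟨γ, -, h, h1⟩
      rwa [← Ordinal.toZFSet_injective h1]
    · exact fun h => ⟨ξ.1, ξ.2, h, rfl⟩
  rw [measureCode, ZFSet.mem_sep, h, ZFSet.mem_powerset]
  exact and_iff_right fun z hz => (ZFSet.mem_sep.1 hz).1

/-- In the ultrapower by a normal measure on `α`, the class of `ξ ↦ X ∩ ξ` is `X ∩ α`. -/
theorem collapse_setCode {α : Ordinal.{u}} {D : Filter (Iio α)} (hD : IsMeasure α D)
    (X : Set Ordinal.{u}) :
    collapse hD ((fun ξ => setCode X ξ.1 : Iio α → ZFSet.{u}) : Ult D) = setCode X α := by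
  ext z
  rw [mem_collapse_coe, mem_setCode]
  constructor
  · rintro ⟨f, hf, rfl⟩
    obtain ⟨γ, hγ, h⟩ := hD.exists_eventually_eq_toZFSet
      (hf.mono fun ξ hξ => (ZFSet.mem_sep.1 hξ).1)
    have := hD.neBot
    obtain ⟨ξ, h1, h2⟩ := (hf.and h).exists
    obtain ⟨β, -, hβ, h3⟩ := mem_setCode.1 h1
    rw [h2] at h3
    exact ⟨γ, hγ, Ordinal.toZFSet_injective h3 ▸ hβ,
      by rw [collapse_congr hD h, collapse_const_toZFSet hD hγ]⟩
  · rintro ⟨γ, hγ, hX, rfl⟩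
    refine ⟨fun _ => γ.toZFSet, ?_, collapse_const_toZFSet hD hγ⟩
    filter_upwards [hD.eventually_gt hγ] with ξ hξ
    exact mem_setCode.2 ⟨γ, hξ, hX, rfl⟩

/-- In the ultrapower by a normal measure on `α`, the class of the identity is `α`. -/
theorem collapse_id {α : Ordinal.{u}} {D : Filter (Iio α)} (hD : IsMeasure α D) :
    collapse hD ((fun ξ => ξ.1.toZFSet : Iio α → ZFSet.{u}) : Ult D) = α.toZFSet := by
  simpa only [setCode_univ] using collapse_setCode hD univ

theorem mem_sequenceCode {l : Ordinal.{u}} {o : Ordinal.{u} → Ordinal.{u}}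
    {U : ∀ α : Ordinal.{u}, Ordinal.{u} → Filter (Iio α)} {z : ZFSet.{u}} :
    z ∈ sequenceCode l o U ↔ ∃ α < l, ∃ β < o α,
      z = ZFSet.pair (ZFSet.pair α.toZFSet β.toZFSet) (measureCode (U α β)) := by
  rw [sequenceCode, ZFSet.mem_range]
  constructor
  · rintro ⟨⟨⟨α, hα⟩, ⟨β, hβ⟩⟩, rfl⟩
    exact ⟨α, hα, β, hβ, rfl⟩
  · rintro ⟨α, hα, β, hβ, rfl⟩
    exact ⟨⟨⟨α, hα⟩, ⟨β, hβ⟩⟩, rfl⟩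

theorem pair_mem_restrict {F v : ZFSet.{u}} {α β α' β' : Ordinal.{u}} :
    ZFSet.pair (ZFSet.pair α'.toZFSet β'.toZFSet) v ∈ restrict F α β ↔
      ZFSet.pair (ZFSet.pair α'.toZFSet β'.toZFSet) v ∈ F ∧ (α' < α ∨ α' = α ∧ β' < β) := by
  rw [restrict, ZFSet.mem_sep]
  refine and_congr_right fun _ => ⟨?_, fun h => ⟨α', β', v, h, rfl⟩⟩
  rintro ⟨a, b, w, h, heq⟩
  obtain ⟨h1, -⟩ := ZFSet.pair_inj.1 heq
  obtain ⟨h2, h3⟩ := ZFSet.pair_inj.1 h1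
  rwa [Ordinal.toZFSet_injective h2, Ordinal.toZFSet_injective h3]

/-! ### Coherence -/

namespace CoherentSequence

/-- Reflection of the measures below `U^lam_δ`: a set `X` belongs to an earlier measure on `lam` if
and only if `X ∩ ξ` belongs to some measure on `ξ`, for `U^lam_δ`-almost all `ξ`. -/
theorem exists_lt_mem_iff (S : CoherentSequence.{u}) {lam δ : Ordinal.{u}} (hlam : lam < S.length)
    (hδ : δ < S.o lam) (X : Set Ordinal.{u}) :
    (∃ δ' < δ, Subtype.val ⁻¹' X ∈ S.U lam δ') ↔
      ∀ᶠ ξ in S.U lam δ, ∃ β < S.o ξ.1, Subtype.val ⁻¹' X ∈ S.U ξ.1 β := by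
  have hD := S.isMeasure lam hlam δ hδ
  have := hD.neBot
  have hcoh := S.coherent lam hlam δ hδ
  constructor
  · rintro ⟨δ', hδ', hX⟩
    have h1 : ZFSet.pair (ZFSet.pair lam.toZFSet δ'.toZFSet) (measureCode (S.U lam δ')) ∈
        restrict (sequenceCode S.length S.o S.U) lam δ :=
      pair_mem_restrict.2
        ⟨mem_sequenceCode.2 ⟨lam, hlam, δ', hδ'.trans hδ, rfl⟩, Or.inr ⟨rfl, hδ'⟩⟩
    -- Coherence puts the entry for `δ'` into `j(U)`, so it is represented by a choice of entries
    -- `((a ξ, b ξ), U (a ξ) (b ξ))`. Comparing first coordinates with the identity yields `a ξ = ξ`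
    -- almost everywhere.
    rw [← hcoh, pair_mem_restrict, canonicalEmbedding, mem_collapse_coe] at h1
    obtain ⟨⟨f, hf, hfeq⟩, -⟩ := h1
    obtain ⟨a, ha⟩ := (hf.mono fun ξ hξ => mem_sequenceCode.1 hξ).choice
    obtain ⟨b, hb⟩ := (ha.mono fun ξ hξ => hξ.2).choice
    rw [collapse_congr hD (hb.mono fun ξ hξ => hξ.2), collapse_pair hD
      (fun ξ => ZFSet.pair (a ξ).toZFSet (b ξ).toZFSet) (fun ξ => measureCode (S.U (a ξ) (b ξ))),
      collapse_pair hD (fun ξ => (a ξ).toZFSet) (fun ξ => (b ξ).toZFSet), ZFSet.pair_inj,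
      ZFSet.pair_inj, ← collapse_id hD, collapse_eq_collapse_iff] at hfeq
    obtain ⟨⟨hid, -⟩, hU⟩ := hfeq
    rw [← setCode_mem_measureCode, ← hU, ← collapse_setCode hD, collapse_mem_collapse_iff] at hX
    filter_upwards [hid, hX, hb] with ξ h2 h3 h4
    have h5 := Ordinal.toZFSet_injective h2
    rw [h5] at h3 h4
    exact ⟨b ξ, h4.1, setCode_mem_measureCode.1 h3⟩
  · intro h
    obtain ⟨b, hb⟩ := h.choice
    -- The indices `b ξ` represent an ordinal `β`. The resulting entry of `j(U)` at `(lam, β)` is by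
    -- coherence an entry of `U` below `(lam, δ)`, so `β < δ` and its value is `U lam β`.
    obtain ⟨β, hβ⟩ : collapse hD ((fun ξ => (b ξ).toZFSet : Iio lam → ZFSet.{u}) : Ult _) ∈
        range Ordinal.toZFSet :=
      ZFSet.isOrdinal_iff_mem_range_toZFSet.1 <|
        isOrdinal_collapse hD (Eventually.of_forall fun ξ => ZFSet.isOrdinal_toZFSet _)
    have h1 : ZFSet.pair (ZFSet.pair lam.toZFSet β.toZFSet)
        (collapse hD ((fun ξ => measureCode (S.U ξ.1 (b ξ)) : Iio lam → ZFSet.{u}) : Ult _)) ∈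
        restrict (canonicalEmbedding hD (sequenceCode S.length S.o S.U)) (lam + 1) 0 := by
      refine pair_mem_restrict.2 ⟨?_, Or.inl (lt_add_one lam)⟩
      rw [hβ, ← collapse_id hD, ← collapse_pair, ← collapse_pair, canonicalEmbedding,
        collapse_mem_collapse_iff]
      filter_upwards [hb] with ξ hξ
      exact mem_sequenceCode.2 ⟨ξ.1, ξ.2.trans hlam, b ξ, hξ.1, rfl⟩
    rw [hcoh, pair_mem_restrict] at h1
    obtain ⟨hmem, hlt⟩ := h1
    have hβδ : β < δ := (hlt.resolve_left (lt_irrefl _)).2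
    obtain ⟨a, -, c, -, heq⟩ := mem_sequenceCode.1 hmem
    obtain ⟨h2, h3⟩ := ZFSet.pair_inj.1 heq
    obtain ⟨h4, h5⟩ := ZFSet.pair_inj.1 h2
    obtain rfl := Ordinal.toZFSet_injective h4
    obtain rfl := Ordinal.toZFSet_injective h5
    refine ⟨β, hβδ, ?_⟩
    rw [← setCode_mem_measureCode, ← h3, ← collapse_setCode hD, collapse_mem_collapse_iff]
    filter_upwards [hb] with ξ hξ
    exact setCode_mem_measureCode.2 hξ.2

theorem exists_separating_set (S : CoherentSequence.{u}) {lam δ : Ordinal.{u}}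
    (hlam : lam < S.length) (hδ : δ < S.o lam) (hrep : ¬ S.IsRepeatPoint lam δ) :
    ∃ E ∈ S.U lam δ, ∀ δ' < S.o lam, δ' ≠ δ → E ∉ S.U lam δ' := by
  simp only [IsRepeatPoint, not_forall] at hrep
  obtain ⟨X, hX, hXlt⟩ := hrep
  -- A set of ordinals, unlike a subset of `Iio lam`, can be traced on every `ξ`.
  obtain ⟨Y, rfl⟩ : ∃ Y : Set Ordinal.{u}, Subtype.val ⁻¹' Y = X :=
    ⟨_, preimage_image_eq X Subtype.val_injective⟩
  let P : Iio lam → Prop := fun ξ => ∃ β < S.o ξ.1, Subtype.val ⁻¹' Y ∈ S.U ξ.1 β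
  have hP : ∀ᶠ ξ in S.U lam δ, ¬ P ξ :=
    (S.isMeasure lam hlam δ hδ).eventually_not_iff.2 fun h =>
      hXlt ((S.exists_lt_mem_iff hlam hδ Y).2 h)
  refine ⟨Subtype.val ⁻¹' Y ∩ {ξ | ¬ P ξ}, inter_mem hX hP, fun δ' hδ' hne hE => ?_⟩
  rcases lt_or_gt_of_ne hne with hlt | hgt
  · exact hXlt ⟨δ', hlt, mem_of_superset hE inter_subset_left⟩
  · exact (S.isMeasure lam hlam δ' hδ').eventually_not_iff.1
      (mem_of_superset hE inter_subset_right)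
      ((S.exists_lt_mem_iff hlam hδ' Y).1 ⟨δ, hgt, hX⟩)

theorem lt_o_and_not_isRepeatPoint_of_lt_theta (S : CoherentSequence.{u}) {lam δ : Ordinal.{u}}
    (h : δ < S.theta lam) : δ < S.o lam ∧ ¬ S.IsRepeatPoint lam δ := by
  unfold theta at h
  split_ifs at h with hex
  · have hlt : δ < S.o lam := h.trans (csInf_mem (s := {θ | θ < S.o lam ∧ _}) hex).1
    exact ⟨hlt, fun hr => notMem_of_lt_csInf' h ⟨hlt, hr⟩⟩
  · exact ⟨h, fun hr => hex ⟨δ, h, hr⟩⟩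

end CoherentSequence

end MitchellOrder

open MitchellOrder in
theorem proposition3p1 (S : CoherentSequence.{u}) (lam : Ordinal.{u}) (hlam : lam < S.length) :
    (∀ δ < S.o lam, ¬ S.IsRepeatPoint lam δ →
      ∃ E ∈ S.U lam δ, ∀ δ' < S.o lam, δ' ≠ δ → E ∉ S.U lam δ') ∧
    (∃ E : Ordinal.{u} → Set (Set.Iio lam), ∀ δ < S.theta lam,
      E δ ⊆ Reg lam ∧ ∀ δ' < S.o lam, (E δ ∈ S.U lam δ' ↔ δ = δ')) := by
  refine ⟨fun δ hδ hrep => S.exists_separating_set hlam hδ hrep, ?_⟩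
  have hsep : ∀ δ, ∃ E : Set (Set.Iio lam), δ < S.theta lam →
      E ⊆ Reg lam ∧ ∀ δ' < S.o lam, (E ∈ S.U lam δ' ↔ δ = δ') := by
    intro δ
    by_cases hθ : δ < S.theta lam
    · obtain ⟨hδ, hrep⟩ := S.lt_o_and_not_isRepeatPoint_of_lt_theta hθ
      obtain ⟨E, hE, hne⟩ := S.exists_separating_set hlam hδ hrep
      refine ⟨E ∩ Reg lam, fun _ => ⟨Set.inter_subset_right, fun δ' hδ' => ⟨fun h => ?_, ?_⟩⟩⟩
      · by_contra hcon
        exact hne δ' hδ' (Ne.symm hcon) (Filter.mem_of_superset h Set.inter_subset_left)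
      · rintro rfl
        exact Filter.inter_mem hE (S.isMeasure lam hlam δ hδ).reg_mem
    · exact ⟨∅, fun h => absurd h hθ⟩
  choose E hE using hsep
  exact ⟨E, hE⟩
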